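/- Let $K$ be a field, $n\ge 0$ an integer, $S=K[x_{ij} : 1\le i,j\le n]$, and let $G$ be a simple graph on the vertex set $[n]=\{1,\dots,n\}$. Let $P_G\subset S$ be the ideal generated by the diagonal $2$-minors $f_{ij}=x_{ii}x_{jj}-x_{ij}x_{ji}$, where $i<j$ and $\{i,j\}$ is an edge of $G$. Consider on $S$ the lexicographic order induced by $$x_{11}>x_{12}>\cdots>x_{1n}>x_{21}>x_{22}>\cdots>x_{2n}>\cdots>x_{n1}>\cdots>x_{nn}.$$ Then the initial ideal of $P_G$ is generated by squarefree monomials of degree at most $4$. Moreover, the reduced Gröbner basis of $P_G$ with respect to this order (which exists and is unique) consists of binomials, that is, differences $x^u-x^v$ of two distinct monomials, each of which has total degree $2$, $3$ or $4$ and a squarefree initial monomial. -/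

import Mathlib

noncomputable section

open MvPolynomial

/-- Index set of the variables `x_{ij}`, `i, j ∈ [n]`, of an `n × n` matrix. It is ordered
row by row, from left to right: `(1,1) < (1,2) < ⋯ < (1,n) < (2,1) < ⋯ < (n,n)`. -/
abbrev MatIdx (n : ℕ) : Type := Fin n ×ₗ Fin n

/-- The variable `x_{ij}` of the polynomial ring `S = K[x_{ij}]`. -/
def matVar (K : Type*) [Field K] {n : ℕ} (i j : Fin n) : MvPolynomial (MatIdx n) K :=
  X (toLex (i, j))

/-- The diagonal 2-minor `f_{ij} = x_{ii} x_{jj} - x_{ij} x_{ji}`. -/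
def diagMinor (K : Type*) [Field K] {n : ℕ} (i j : Fin n) : MvPolynomial (MatIdx n) K :=
  matVar K i i * matVar K j j - matVar K i j * matVar K j i

/-- The ideal `P_G` generated by the `f_{ij}`, `i < j`, with `{i, j}` an edge of `G`. -/
def diagMinorIdeal (K : Type*) [Field K] {n : ℕ} (G : SimpleGraph (Fin n)) :
    Ideal (MvPolynomial (MatIdx n) K) :=
  Ideal.span {f | ∃ i j : Fin n, i < j ∧ G.Adj i j ∧ f = diagMinor K i j}

/-- The lexicographic order with `x_{11} > x_{12} > ⋯ > x_{1n} > x_{21} > ⋯ > x_{nn}`.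
In `MonomialOrder.lex` a smaller index gives a larger variable. -/
def matLex (n : ℕ) : MonomialOrder (MatIdx n) := MonomialOrder.lex

section Groebner

variable {σ K : Type*} [Field K]

/-- The initial ideal of `I`: the ideal generated by the leading terms of the elements of `I`
(over a field, equivalently by the initial monomials of its nonzero elements). -/
def initialIdeal (m : MonomialOrder σ) (I : Ideal (MvPolynomial σ K)) :
    Ideal (MvPolynomial σ K) :=
  Ideal.span (m.leadingTerm '' (I : Set (MvPolynomial σ K)))

/-- `B` is a reduced Gröbner basis of `I` with respect to `m`: its elements lie in `I`, their
leading terms generate the initial ideal, they are monic, and no monomial occurring in an element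
of `B` is divisible by the initial monomial of another element of `B`. -/
structure IsReducedGroebnerBasis (m : MonomialOrder σ) (I : Ideal (MvPolynomial σ K))
    (B : Finset (MvPolynomial σ K)) : Prop where
  subset : (B : Set (MvPolynomial σ K)) ⊆ I
  span_leadingTerm :
    Ideal.span (m.leadingTerm '' (B : Set (MvPolynomial σ K))) = initialIdeal m I
  monic : ∀ g ∈ B, m.Monic g
  reduced : ∀ g ∈ B, ∀ h ∈ B, g ≠ h → ∀ e ∈ g.support, ¬ m.degree h ≤ e

/-- A binomial: a difference of two distinct monomials. -/
def IsBinomial (g : MvPolynomial σ K) : Prop :=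
  ∃ u v : σ →₀ ℕ, u ≠ v ∧ g = monomial u 1 - monomial v 1

/-- The monomial with exponent vector `e` is squarefree. -/
def SquarefreeExp (e : σ →₀ ℕ) : Prop := ∀ x, e x ≤ 1

end Groebner

end

/-!
The ideal `P_G` identifies `x_{ii} x_{jj}` with `x_{ij} x_{ji}` for every edge `{i, j}`. Two
families of linear functionals of the exponent matrix are constant under this identification: the
row sums, and the differences `e_{ij} - e_{ji}` on edges together with the entries `e_{ij}` off the
diagonal at non-edges. They are collected in the grading `rowDiff`. As `P_G` is homogeneous for it,
the initial monomial `u` of a nonzero `f ∈ P_G` has the same grade as a smaller monomial `v` of `f`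
(`exists_lt_of_mem_diagMinorIdeal`).

The difference `d = u - v` is then an integer matrix with zero row sums which is symmetric and
vanishes off the diagonal at non-edges, and whose first nonzero entry is positive. Following the
signs of `d` along at most three rows produces at most four distinct positions at which `d` is
positive, and a monomial in later variables congruent to the product of these positions modulo
`P_G` (`exists_binomial_of_rowDiff_eq`). With `y_{ij} = x_{ij} x_{ji}`, the binomials are
`x_{ii} x_{jj} - y_{ij}`, `x_{ii} y_{jk} - x_{kk} y_{ij}`, `y_{ij} x_{kk} - y_{ik} x_{jj}` and
`y_{ij} y_{kl} - y_{ik} x_{jj} x_{ll}`. So the initial ideal is generated by squarefree monomials of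
degree at most `4`.

The statement on the reduced Gröbner basis follows formally: subtracting from each minimal
generator of the initial ideal the least monomial congruent to it modulo `P_G` gives a reduced
Gröbner basis, and reduced Gröbner bases are unique. The grading forces both monomials of each such
binomial to have the same degree.
-/

open MvPolynomial
open scoped MonomialOrder

/-! ### Reduced Gröbner bases -/

section ReducedBasis

variable {σ K : Type*} [Field K] {m : MonomialOrder σ} {I : Ideal (MvPolynomial σ K)}

lemma MonomialOrder.Monic.leadingTerm_eq {g : MvPolynomial σ K} (hg : m.Monic g) :
    m.leadingTerm g = monomial (m.degree g) 1 := by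
  rw [MonomialOrder.leadingTerm, hg.leadingCoeff_eq_one]

lemma span_leadingTerm_eq_of_monic {B : Set (MvPolynomial σ K)} (hB : ∀ g ∈ B, m.Monic g) :
    Ideal.span (m.leadingTerm '' B) =
      Ideal.span ((fun e => monomial e (1 : K)) '' (m.degree '' B)) := by
  rw [Set.image_image]
  congr 1
  exact Set.image_congr fun g hg => (hB g hg).leadingTerm_eq

lemma monomial_degree_mem_initialIdeal {f : MvPolynomial σ K} (hf : f ∈ I) (h0 : f ≠ 0) :
    monomial (m.degree f) (1 : K) ∈ initialIdeal m I := by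
  have h : m.leadingTerm f ∈ initialIdeal m I := Ideal.subset_span ⟨f, hf, rfl⟩
  have h1 := Ideal.mul_mem_left _ (C (m.leadingCoeff f)⁻¹) h
  rwa [MonomialOrder.leadingTerm, C_mul_monomial,
    inv_mul_cancel₀ (m.leadingCoeff_ne_zero_iff.2 h0)] at h1

lemma monomial_mem_span_monomial_iff {A : Set (σ →₀ ℕ)} {e : σ →₀ ℕ} :
    monomial e (1 : K) ∈ Ideal.span ((fun e => monomial e (1 : K)) '' A) ↔ ∃ a ∈ A, a ≤ e := by
  classical
  rw [mem_ideal_span_monomial_image]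
  simp [support_monomial]

lemma IsReducedGroebnerBasis.exists_degree_le {B : Finset (MvPolynomial σ K)}
    (hB : IsReducedGroebnerBasis m I B) {f : MvPolynomial σ K} (hf : f ∈ I) (h0 : f ≠ 0) :
    ∃ g ∈ B, m.degree g ≤ m.degree f := by
  have h := monomial_degree_mem_initialIdeal (m := m) hf h0
  rw [← hB.span_leadingTerm, span_leadingTerm_eq_of_monic hB.monic,
    monomial_mem_span_monomial_iff] at h
  obtain ⟨_, ⟨g, hg, rfl⟩, hle⟩ := h
  exact ⟨g, hg, hle⟩

/-- In an element of a reduced Gröbner basis, no monomial other than the initial one is divisible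
by an initial monomial of the basis. -/
lemma IsReducedGroebnerBasis.not_degree_le {B : Finset (MvPolynomial σ K)}
    (hB : IsReducedGroebnerBasis m I B) {g h : MvPolynomial σ K} (hg : g ∈ B) (hh : h ∈ B)
    {e : σ →₀ ℕ} (he : e ∈ g.support) (hne : e ≠ m.degree g) : ¬ m.degree h ≤ e := by
  intro hle
  by_cases hgh : g = h
  · subst hgh
    exact hne (m.toSyn.injective ((m.le_degree he).antisymm (m.toSyn_monotone hle)))
  · exact hB.reduced g hg h hh hgh e he hle

lemma IsReducedGroebnerBasis.subset_of {B B' : Finset (MvPolynomial σ K)}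
    (hB : IsReducedGroebnerBasis m I B) (hB' : IsReducedGroebnerBasis m I B') : B ⊆ B' := by
  intro g hg
  have hg0 := (hB.monic g hg).ne_zero
  obtain ⟨g', hg', h1⟩ := hB'.exists_degree_le (hB.subset hg) hg0
  obtain ⟨g'', hg'', h2⟩ :=
    hB.exists_degree_le (hB'.subset hg') (hB'.monic g' hg').ne_zero
  have hgg : g = g'' := by
    by_contra hne
    exact hB.reduced g hg g'' hg'' hne _ (m.degree_mem_support hg0) (h2.trans h1)
  subst hgg
  have hdeg : m.degree g = m.degree g' := le_antisymm h2 h1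
  suffices h : g - g' = 0 by rwa [sub_eq_zero.1 h]
  by_contra h0
  have hI : g - g' ∈ I := I.sub_mem (hB.subset hg) (hB'.subset hg')
  -- The initial monomials of `g` and `g'` cancel, so that of `g - g'` is a lower monomial of one.
  have hne : m.degree (g - g') ≠ m.degree g := by
    intro h
    have hc := m.coeff_degree_ne_zero_iff.2 h0
    rw [h, coeff_sub, (hB.monic g hg).coeff_degree, hdeg, (hB'.monic g' hg').coeff_degree,
      sub_self] at hc
    exact hc rfl
  classical
  rcases Finset.mem_union.1 (support_sub σ g g' (m.degree_mem_support h0)) with h | h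
  · obtain ⟨k, hk, hle⟩ := hB.exists_degree_le hI h0
    exact hB.not_degree_le hg hk h hne hle
  · obtain ⟨k, hk, hle⟩ := hB'.exists_degree_le hI h0
    exact hB'.not_degree_le hg' hk h (hdeg ▸ hne) hle

lemma IsReducedGroebnerBasis.unique {B B' : Finset (MvPolynomial σ K)}
    (hB : IsReducedGroebnerBasis m I B) (hB' : IsReducedGroebnerBasis m I B') : B = B' :=
  (hB.subset_of hB').antisymm (hB'.subset_of hB)

/-- `u` is the initial monomial of a binomial `x^u - x^v` in `I`. -/
def IsBinomialLead (m : MonomialOrder σ) (I : Ideal (MvPolynomial σ K)) (u : σ →₀ ℕ) : Prop :=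
  ∃ v, v ≺[m] u ∧ monomial u (1 : K) - monomial v 1 ∈ I

lemma degree_binomial {u v : σ →₀ ℕ} (h : v ≺[m] u) :
    m.degree (monomial u (1 : K) - monomial v 1) = u := by
  classical
  have hd (w : σ →₀ ℕ) : m.degree (monomial w (1 : K)) = w := by simp [m.degree_monomial]
  rw [m.degree_sub_of_lt (by rwa [hd, hd]), hd]

lemma monic_binomial {u v : σ →₀ ℕ} (h : v ≺[m] u) :
    m.Monic (monomial u (1 : K) - monomial v 1) := by
  classical
  have hd (w : σ →₀ ℕ) : m.degree (monomial w (1 : K)) = w := by simp [m.degree_monomial]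
  rw [MonomialOrder.Monic, m.leadingCoeff_sub_of_lt (by rwa [hd, hd]), m.leadingCoeff_monomial]

lemma monomial_mem_initialIdeal_of_isBinomialLead {u : σ →₀ ℕ} (h : IsBinomialLead m I u) :
    monomial u (1 : K) ∈ initialIdeal m I := by
  obtain ⟨v, hv, hI⟩ := h
  have := monomial_degree_mem_initialIdeal (m := m) hI (monic_binomial hv).ne_zero
  rwa [degree_binomial hv] at this

/-- The normal form of an initial monomial is the least monomial congruent to it; being least, it
is divisible by no initial monomial of a binomial. -/
lemma IsBinomialLead.exists_normalForm {u : σ →₀ ℕ} (h : IsBinomialLead m I u) :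
    ∃ v, v ≺[m] u ∧ monomial u (1 : K) - monomial v 1 ∈ I ∧
      ∀ w, IsBinomialLead m I w → ¬ w ≤ v := by
  obtain ⟨v₀, hv₀, hI₀⟩ := h
  let T : Set m.syn := {s | monomial u (1 : K) - monomial (m.toSyn.symm s) 1 ∈ I}
  have hT : m.toSyn v₀ ∈ T := by simpa [T] using hI₀
  obtain ⟨s, hs, hmin⟩ := WellFounded.has_min (wellFounded_lt (α := m.syn)) T ⟨_, hT⟩
  refine ⟨m.toSyn.symm s, ?_, hs, ?_⟩
  · rw [AddEquiv.apply_symm_apply]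
    exact (not_lt.1 (hmin _ hT)).trans_lt hv₀
  · rintro w ⟨w', hw', hwI⟩ hle
    obtain ⟨c, hc⟩ := exists_add_of_le hle
    refine hmin (m.toSyn (w' + c)) ?_ ?_
    · have h1 := I.add_mem hs (I.mul_mem_left (monomial c 1) hwI)
      have h2 : monomial u (1 : K) - monomial (w' + c) 1 ∈ I := by
        rw [hc, mul_sub, monomial_mul, monomial_mul, one_mul, add_comm c w, add_comm c w'] at h1
        simpa using h1
      simpa [T] using h2
    · have h3 : s = m.toSyn w + m.toSyn c := by
        rw [← map_add, ← hc, AddEquiv.apply_symm_apply]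
      rw [h3, map_add]
      exact add_lt_add_left hw' _

/-- If the initial ideal is generated by a finite set of initial monomials of binomials of `I`,
then `I` has a reduced Gröbner basis consisting of binomials, with initial monomials from this
set. -/
lemma exists_reducedGroebnerBasis_binomial {L : Set (σ →₀ ℕ)} (hfin : L.Finite)
    (hL : ∀ u ∈ L, IsBinomialLead m I u)
    (hspan : initialIdeal m I = Ideal.span ((fun e => monomial e (1 : K)) '' L)) :
    ∃ B : Finset (MvPolynomial σ K), IsReducedGroebnerBasis m I B ∧
      ∀ g ∈ B, ∃ u ∈ L, ∃ v, v ≺[m] u ∧ g = monomial u 1 - monomial v 1 := by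
  classical
  choose! nf hlt hmem hnf using fun u hu => (hL u hu).exists_normalForm
  let M : Set (σ →₀ ℕ) := {u | Minimal (· ∈ L) u}
  have hML : M ⊆ L := fun u hu => hu.prop
  have hMfin : M.Finite := hfin.subset hML
  let b : (σ →₀ ℕ) → MvPolynomial σ K := fun u => monomial u 1 - monomial (nf u) 1
  have hmonic : ∀ u ∈ L, m.Monic (b u) := fun u hu => monic_binomial (hlt u hu)
  have hdeg : ∀ u ∈ L, m.degree (b u) = u := fun u hu => degree_binomial (hlt u hu)
  refine ⟨hMfin.toFinset.image b, ⟨?_, ?_, ?_, ?_⟩, ?_⟩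
  · intro g hg
    simp only [Finset.coe_image, Set.Finite.coe_toFinset] at hg
    obtain ⟨u, hu, rfl⟩ := hg
    exact hmem u (hML hu)
  · simp only [Finset.coe_image, Set.Finite.coe_toFinset]
    rw [span_leadingTerm_eq_of_monic (by rintro _ ⟨u, hu, rfl⟩; exact hmonic u (hML hu)),
      Set.image_image m.degree, Set.image_congr (fun u hu => hdeg u (hML hu)), Set.image_id', hspan]
    refine le_antisymm (Ideal.span_mono (Set.image_mono hML)) (Ideal.span_le.2 ?_)
    rintro _ ⟨e, he, rfl⟩
    obtain ⟨a, hle, ha⟩ := hfin.exists_le_minimal he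
    exact monomial_mem_span_monomial_iff.2 ⟨a, ha, hle⟩
  · intro g hg
    simp only [Finset.mem_image, Set.Finite.mem_toFinset] at hg
    obtain ⟨u, hu, rfl⟩ := hg
    exact hmonic u (hML hu)
  · intro g hg h hh hne e he
    simp only [Finset.mem_image, Set.Finite.mem_toFinset] at hg hh
    obtain ⟨u, hu, rfl⟩ := hg
    obtain ⟨w, hw, rfl⟩ := hh
    rw [hdeg w (hML hw)]
    intro hle
    rcases Finset.mem_union.1 (support_sub σ _ _ he) with h | h
    · obtain rfl := Finset.mem_singleton.1 (support_monomial_subset h)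
      exact hne (congrArg b (hu.eq_of_le hw.prop hle).symm)
    · obtain rfl := Finset.mem_singleton.1 (support_monomial_subset h)
      exact hnf u (hML hu) w (hL w (hML hw)) hle
  · intro g hg
    simp only [Finset.mem_image, Set.Finite.mem_toFinset] at hg
    obtain ⟨u, hu, rfl⟩ := hg
    exact ⟨u, hML hu, nf u, hlt u (hML hu), rfl⟩

end ReducedBasis

/-! ### The grading by row sums and antisymmetric parts -/

section Grading

variable {n : ℕ}

/-- The grading of monomials for which `P_G` is homogeneous. The first component holds the row sums
of the exponent matrix `e`. The second holds `e_{ij} - e_{ji}` at the edges `{i, j}` and `e_{ij}` at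
the other off-diagonal positions; it is zero on the diagonal. -/
noncomputable def rowDiff (G : SimpleGraph (Fin n)) :
    (MatIdx n →₀ ℕ) →+ (Fin n → ℤ) × (Fin n → Fin n → ℤ) := by
  classical
  exact
  { toFun := fun e => (fun i => ∑ j, (e (toLex (i, j)) : ℤ), fun i j =>
      if i = j then 0 else if G.Adj i j then e (toLex (i, j)) - e (toLex (j, i))
      else e (toLex (i, j)))
    map_zero' := by ext <;> simp
    map_add' := fun a b => by
      ext i j
      · simp [Finset.sum_add_distrib]
      · simp only [Finsupp.add_apply, Prod.snd_add, Pi.add_apply]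
        split_ifs <;> push_cast <;> ring }

lemma rowDiff_eq_iff {G : SimpleGraph (Fin n)} {u v : MatIdx n →₀ ℕ} :
    rowDiff G u = rowDiff G v ↔
      (∀ i, ∑ j, (u (toLex (i, j)) : ℤ) = ∑ j, (v (toLex (i, j)) : ℤ)) ∧
      (∀ i j, G.Adj i j → (u (toLex (i, j)) : ℤ) - u (toLex (j, i)) =
        v (toLex (i, j)) - v (toLex (j, i))) ∧
      ∀ i j, i ≠ j → ¬ G.Adj i j → u (toLex (i, j)) = v (toLex (i, j)) := by
  classical
  simp only [rowDiff, AddMonoidHom.coe_mk, ZeroHom.coe_mk, Prod.mk.injEq, funext_iff]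
  refine and_congr_right fun _ => ⟨fun h => ⟨fun i j hij => ?_, fun i j hij hG => ?_⟩,
    fun h i j => ?_⟩
  · simpa [hij.ne, hij] using h i j
  · simpa [hij, hG] using h i j
  · split_ifs with h1 h2
    · rfl
    · exact h.1 i j h2
    · exact congrArg _ (h.2 i j h1 h2)

lemma degree_eq_of_rowDiff_eq {G : SimpleGraph (Fin n)} {u v : MatIdx n →₀ ℕ}
    (h : rowDiff G u = rowDiff G v) : u.degree = v.degree := by
  have hd (e : MatIdx n →₀ ℕ) : (e.degree : ℤ) = ∑ i, ∑ j, (e (toLex (i, j)) : ℤ) := by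
    rw [Finsupp.degree_eq_sum, ← Equiv.sum_comp toLex, Fintype.sum_prod_type]
    push_cast
    rfl
  have := Finset.sum_congr rfl fun i (_ : i ∈ Finset.univ) => (rowDiff_eq_iff.1 h).1 i
  rw [← hd, ← hd] at this
  exact_mod_cast this

/-- The ring homomorphism `x^e ↦ [rowDiff G e]` to the group algebra of the grading group; its
coefficient at a grade is the sum of the coefficients of all monomials of that grade. -/
noncomputable def gradeMap (K : Type*) [Field K] (G : SimpleGraph (Fin n)) :
    MvPolynomial (MatIdx n) K →+* AddMonoidAlgebra K ((Fin n → ℤ) × (Fin n → Fin n → ℤ)) :=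
  AddMonoidAlgebra.mapDomainRingHom K (rowDiff G)

variable {K : Type*} [Field K] {G : SimpleGraph (Fin n)}

lemma gradeMap_monomial (e : MatIdx n →₀ ℕ) (c : K) :
    gradeMap K G (monomial e c) = AddMonoidAlgebra.single (rowDiff G e) c :=
  AddMonoidAlgebra.mapDomain_single

lemma gradeMap_eq_zero {f : MvPolynomial (MatIdx n) K} (hf : f ∈ diagMinorIdeal K G) :
    gradeMap K G f = 0 := by
  classical
  suffices h : diagMinorIdeal K G ≤ RingHom.ker (gradeMap K G) from h hf
  refine Ideal.span_le.2 ?_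
  rintro _ ⟨i, j, hij, hG, rfl⟩
  simp only [SetLike.mem_coe, RingHom.mem_ker, diagMinor, matVar, X, monomial_mul, map_sub,
    gradeMap_monomial, mul_one]
  rw [sub_eq_zero]
  congr 1
  rw [rowDiff_eq_iff]
  have hne := hij.ne
  refine ⟨fun a => ?_, fun a b hab => ?_, fun a b hab hnG => ?_⟩
  · by_cases hia : i = a <;> by_cases hja : j = a <;>
      simp [Finsupp.single_apply, Finset.sum_add_distrib, Prod.ext_iff, hia, hja]
  · have hab' := hab.ne
    simp only [Finsupp.add_apply, Finsupp.single_apply, EmbeddingLike.apply_eq_iff_eq,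
      Prod.mk.injEq]
    grind
  · have hsym := hG.symm
    simp only [Finsupp.add_apply, Finsupp.single_apply, EmbeddingLike.apply_eq_iff_eq,
      Prod.mk.injEq]
    grind

lemma rowDiff_eq_of_binomial_mem {u v : MatIdx n →₀ ℕ}
    (h : monomial u (1 : K) - monomial v 1 ∈ diagMinorIdeal K G) :
    rowDiff G u = rowDiff G v := by
  have h1 := gradeMap_eq_zero h
  rw [map_sub, gradeMap_monomial, gradeMap_monomial, sub_eq_zero] at h1
  exact (AddMonoidAlgebra.single_left_inj one_ne_zero).1 h1

/-- The initial monomial of a nonzero element of `P_G` shares its grade with a smaller monomial: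
otherwise its grade would contribute a single nonzero term to the image under `gradeMap`. -/
lemma exists_lt_of_mem_diagMinorIdeal (m : MonomialOrder (MatIdx n))
    {f : MvPolynomial (MatIdx n) K} (hf : f ∈ diagMinorIdeal K G) (h0 : f ≠ 0) :
    ∃ v, v ≺[m] m.degree f ∧ rowDiff G (m.degree f) = rowDiff G v := by
  classical
  by_contra! hcon
  have h1 := gradeMap_eq_zero hf
  rw [f.as_sum, map_sum] at h1
  have h2 := congrArg (fun x => x.coeff (rowDiff G (m.degree f))) h1
  simp only [gradeMap_monomial, AddMonoidAlgebra.coeff_sum, AddMonoidAlgebra.coeff_single,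
    Finsupp.finsetSum_apply, AddMonoidAlgebra.coeff_zero, Finsupp.zero_apply] at h2
  rw [Finset.sum_eq_single (m.degree f)] at h2
  · rw [Finsupp.single_eq_same] at h2
    exact m.coeff_degree_ne_zero_iff.2 h0 h2
  · intro e he hne
    refine Finsupp.single_eq_of_ne (hcon e ?_)
    exact (m.le_degree he).lt_of_ne fun h => hne (m.toSyn.injective h)
  · exact fun h => absurd (m.degree_mem_support h0) h

end Grading

/-! ### Binomials of low degree -/

section Binomials

variable {n : ℕ} {K : Type*} [Field K] {G : SimpleGraph (Fin n)}

lemma diagMinor_mem {i j : Fin n} (h : G.Adj i j) : diagMinor K i j ∈ diagMinorIdeal K G := by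
  rcases lt_or_gt_of_ne h.ne with hij | hij
  · exact Ideal.subset_span ⟨i, j, hij, h, rfl⟩
  · have : diagMinor K i j = diagMinor K j i := by simp only [diagMinor]; ring
    rw [this]
    exact Ideal.subset_span ⟨j, i, hij, h.symm, rfl⟩

lemma monomial_toFinsupp (s : Multiset (MatIdx n)) :
    monomial (Multiset.toFinsupp s) (1 : K) = (s.map X).prod := by
  induction s using Multiset.induction with
  | empty => simp
  | cons a s ih =>
    rw [← Multiset.singleton_add, map_add, Multiset.toFinsupp_singleton, Multiset.map_add,
      Multiset.prod_add, ← ih]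
    simp [X, monomial_mul]

/-- A product of variables is smaller than another one for the lexicographic order if the second
contains a variable which precedes all those of the first. -/
lemma toFinsupp_lex_lt {s t : Multiset (MatIdx n)} {p : MatIdx n} (hs : p ∈ s)
    (ht : ∀ q ∈ t, p < q) : Multiset.toFinsupp t ≺[matLex n] Multiset.toFinsupp s := by
  have hp : 0 < Multiset.toFinsupp s p := by simpa using Multiset.count_pos.2 hs
  have h0 (q : MatIdx n) (hq : q ≤ p) : Multiset.toFinsupp t q = 0 := by
    rw [Multiset.toFinsupp_apply, Multiset.count_eq_zero]
    exact fun h => (ht q h).not_ge hq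
  rw [matLex, MonomialOrder.lex_lt_iff]
  by_contra hcon
  rcases (not_lt.1 hcon).eq_or_lt with h | h
  · have h1 := DFunLike.congr_fun (toLex.injective h) p
    have := h0 p le_rfl
    omega
  · obtain ⟨q, hq, hlt⟩ := Finsupp.Lex.lt_iff.1 h
    simp only [ofLex_toLex] at hq hlt
    by_cases hqp : q ≤ p
    · have := h0 q hqp
      omega
    · have h1 := hq p (not_le.1 hqp)
      have := h0 p le_rfl
      omega

/-- The generators of the initial ideal: squarefree monomials of degree `2`, `3` or `4` which are
initial monomials of binomials in `P_G`. -/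
def smallLeads (K : Type*) [Field K] (G : SimpleGraph (Fin n)) : Set (MatIdx n →₀ ℕ) :=
  {u | SquarefreeExp u ∧ 2 ≤ u.degree ∧ u.degree ≤ 4 ∧
    IsBinomialLead (matLex n) (diagMinorIdeal K G) u}

lemma finite_smallLeads : (smallLeads K G).Finite := by
  refine (Set.finite_Iic (Finsupp.equivFunOnFinite.symm fun _ : MatIdx n => 1)).subset ?_
  exact fun u hu q => hu.1 q

/-- A witness that `u` is divisible by a small lead: distinct positions `s` at which `u` exceeds `v`
and a congruent monomial `t`, one of the positions preceding all of `t`. -/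
lemma exists_smallLeads_le {u v : MatIdx n →₀ ℕ} (s t : Multiset (MatIdx n)) (p : MatIdx n)
    (hs : s.Nodup) (h2 : 2 ≤ s.card) (h4 : s.card ≤ 4) (hsu : ∀ q ∈ s, v q < u q) (hp : p ∈ s)
    (ht : ∀ q ∈ t, p < q)
    (hI : (s.map X).prod - (t.map X).prod ∈ diagMinorIdeal K G) :
    ∃ w ∈ smallLeads K G, w ≤ u := by
  have hdeg : (Multiset.toFinsupp s).degree = s.card := by
    rw [← Multiset.toFinsupp_sum_eq s]
    rfl
  refine ⟨Multiset.toFinsupp s, ⟨fun q => ?_, hdeg ▸ h2, hdeg ▸ h4, Multiset.toFinsupp t,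
    toFinsupp_lex_lt hp ht, ?_⟩, fun q => ?_⟩
  · exact Multiset.nodup_iff_count_le_one.1 hs q
  · rwa [monomial_toFinsupp, monomial_toFinsupp]
  · rw [Multiset.toFinsupp_apply]
    by_cases hq : q ∈ s
    · have := hsu q hq
      have := Multiset.nodup_iff_count_le_one.1 hs q
      omega
    · simp [Multiset.count_eq_zero.2 hq]

/-- The combinatorial core: of two monomials of the same grade, the larger one is divisible by an
initial monomial of low degree. -/
lemma exists_binomial_of_rowDiff_eq {u v : MatIdx n →₀ ℕ} (h : rowDiff G u = rowDiff G v)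
    (hlt : v ≺[matLex n] u) : ∃ w ∈ smallLeads K G, w ≤ u := by
  classical
  obtain ⟨hrow, hadj, hnadj⟩ := rowDiff_eq_iff.1 h
  rw [matLex, MonomialOrder.lex_lt_iff] at hlt
  obtain ⟨p, hp, hpos⟩ := Finsupp.Lex.lt_iff.1 hlt
  simp only [ofLex_toLex] at hp hpos
  -- `p` is the first position at which `u` and `v` differ.
  let d : Fin n → Fin n → ℤ := fun i j => u (toLex (i, j)) - v (toLex (i, j))
  have hsum (i) : ∑ j, d i j = 0 := by
    simp only [d, Finset.sum_sub_distrib]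
    rw [hrow, sub_self]
  have hG {i j} (hij : i ≠ j) (hd : d i j ≠ 0) : G.Adj i j := by
    by_contra hn
    exact hd (by simp [d, hnadj i j hij hn])
  have hsymm (i j) : d i j = d j i := by
    by_cases hij : i = j
    · rw [hij]
    by_cases hA : G.Adj i j
    · have := hadj i j hA
      simp only [d]
      omega
    · simp [d, hnadj i j hij hA, hnadj j i (Ne.symm hij) fun h => hA h.symm]
  have hfirst {i j} (hd : d i j ≠ 0) : p ≤ toLex (i, j) := by
    by_contra hn
    exact hd (by simp [d, hp _ (not_le.1 hn)])
  have hval {i j} (hd : 0 < d i j) : v (toLex (i, j)) < u (toLex (i, j)) := by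
    simp only [d] at hd
    omega
  have hneg {i j} (hd : 0 < d i j) : ∃ k, d i k < 0 := by
    by_contra! hc
    exact hd.ne' ((Finset.sum_eq_zero_iff_of_nonneg fun k _ => hc k).1 (hsum i) j (by simp))
  have hposi {i j} (hd : d i j < 0) : ∃ k, 0 < d i k := by
    by_contra! hc
    exact hd.ne ((Finset.sum_eq_zero_iff_of_nonpos fun k _ => hc k).1 (hsum i) j (by simp))
  have hI {i j} (hij : i ≠ j) (hd : d i j ≠ 0) :
      matVar K i i * matVar K j j - matVar K i j * matVar K j i ∈ diagMinorIdeal K G :=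
    diagMinor_mem (hG hij hd)
  obtain ⟨⟨i, j⟩, rfl⟩ := toLex.surjective p
  have hij0 : 0 < d i j := by
    simp only [d]
    omega
  simp only [Prod.Lex.toLex_le_toLex] at hfirst
  -- Signs along three rows: `d i j > 0`, `d i k < 0`, `d k l > 0`. Every position met is at or
  -- after `(i, j)`, so no row precedes `i`, and the entries of row `i` precede all other rows.
  obtain ⟨k, hk⟩ := hneg hij0
  have hik := hfirst hk.ne
  have hki0 : d k i < 0 := hsymm i k ▸ hk
  have hki := hfirst hki0.ne
  obtain ⟨l, hl⟩ := hposi hki0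
  have hkl := hfirst hl.ne'
  have hlk0 : 0 < d l k := hsymm k l ▸ hl
  have hlk := hfirst hlk0.ne'
  have hjk : j ≠ k := by rintro rfl; omega
  have hli : l ≠ i := by rintro rfl; omega
  by_cases hij : i = j
  · subst hij
    have hfik := hI hjk hk.ne
    by_cases hkl' : k = l
    · subst hkl'
      refine exists_smallLeads_le (v := v) {toLex (i, i), toLex (k, k)}
        {toLex (i, k), toLex (k, i)} (toLex (i, i)) ?_ (by simp) (by simp) ?_ (by simp) ?_ ?_
      · simp [hjk]
      · simp [hval hij0, hval hl]
      · simp [Prod.Lex.toLex_lt_toLex]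
        omega
      · simpa [matVar] using hfik
    · have hfkl := hI hkl' hl.ne'
      refine exists_smallLeads_le (v := v) {toLex (i, i), toLex (k, l), toLex (l, k)}
        {toLex (l, l), toLex (i, k), toLex (k, i)} (toLex (i, i)) ?_ (by simp) (by simp) ?_
        (by simp) ?_ ?_
      · simp [hjk, hkl', hli.symm]
      · simp [hval hij0, hval hl, hval hlk0]
      · simp [Prod.Lex.toLex_lt_toLex]
        omega
      · have := sub_mem (Ideal.mul_mem_left _ (matVar K l l) hfik)
          (Ideal.mul_mem_left _ (matVar K i i) hfkl)
        simp only [matVar] at this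
        convert this using 1
        simp
        ring
  · have hji0 : 0 < d j i := hsymm i j ▸ hij0
    have hji := hfirst hji0.ne'
    have hik' : i ≠ k := by rintro rfl; omega
    have hfij := hI hij hij0.ne'
    have hfik := hI hik' hk.ne
    by_cases hkl' : k = l
    · subst hkl'
      refine exists_smallLeads_le (v := v) {toLex (i, j), toLex (j, i), toLex (k, k)}
        {toLex (i, k), toLex (k, i), toLex (j, j)} (toLex (i, j)) ?_ (by simp) (by simp) ?_
        (by simp) ?_ ?_
      · simp [hjk, hij, hik']
      · simp [hval hij0, hval hl, hval hji0]
      · simp [Prod.Lex.toLex_lt_toLex]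
        omega
      · have := sub_mem (Ideal.mul_mem_left _ (matVar K j j) hfik)
          (Ideal.mul_mem_left _ (matVar K k k) hfij)
        simp only [matVar] at this
        convert this using 1
        simp
        ring
    · have hfkl := hI hkl' hl.ne'
      refine exists_smallLeads_le (v := v)
        {toLex (i, j), toLex (j, i), toLex (k, l), toLex (l, k)}
        {toLex (i, k), toLex (k, i), toLex (j, j), toLex (l, l)} (toLex (i, j)) ?_ (by simp)
        (by simp) ?_ (by simp) ?_ ?_
      · simp [hjk, hij, hik', hkl', hli.symm]
      · simp [hval hij0, hval hl, hval hji0, hval hlk0]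
      · simp [Prod.Lex.toLex_lt_toLex]
        omega
      · -- `y_{ij} y_{kl}` and `y_{ik} x_j x_l` are both congruent to `x_i x_j x_k x_l`.
        have := sub_mem (sub_mem
          (Ideal.mul_mem_left _ (matVar K j j * matVar K l l) hfik)
          (Ideal.mul_mem_left _ (matVar K k k * matVar K l l) hfij))
          (Ideal.mul_mem_left _ (matVar K i j * matVar K j i) hfkl)
        simp only [matVar] at this
        convert this using 1
        simp
        ring

lemma initialIdeal_diagMinorIdeal :
    initialIdeal (matLex n) (diagMinorIdeal K G) =
      Ideal.span ((fun e => monomial e (1 : K)) '' smallLeads K G) := by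
  refine le_antisymm (Ideal.span_le.2 ?_) (Ideal.span_le.2 ?_)
  · rintro _ ⟨f, hf, rfl⟩
    by_cases h0 : f = 0
    · simp [h0]
    obtain ⟨v, hlt, hv⟩ := exists_lt_of_mem_diagMinorIdeal (matLex n) hf h0
    have h1 : monomial ((matLex n).degree f) (1 : K) ∈
        Ideal.span ((fun e => monomial e (1 : K)) '' smallLeads K G) :=
      monomial_mem_span_monomial_iff.2 (exists_binomial_of_rowDiff_eq hv hlt)
    have h2 := Ideal.mul_mem_left _ (C ((matLex n).leadingCoeff f)) h1
    rwa [C_mul_monomial, mul_one] at h2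
  · rintro _ ⟨u, hu, rfl⟩
    exact monomial_mem_initialIdeal_of_isBinomialLead hu.2.2.2

end Binomials

/-! ### The Gröbner basis of `P_G` -/

theorem theorem1p2 (K : Type*) [Field K] (n : ℕ) (G : SimpleGraph (Fin n)) :
    (∃ A : Set (MatIdx n →₀ ℕ),
      (∀ e ∈ A, SquarefreeExp e ∧ e.degree ≤ 4) ∧
      initialIdeal (matLex n) (diagMinorIdeal K G) =
        Ideal.span ((fun e => MvPolynomial.monomial e (1 : K)) '' A)) ∧
    (∃ B : Finset (MvPolynomial (MatIdx n) K),
      IsReducedGroebnerBasis (matLex n) (diagMinorIdeal K G) B ∧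
      (∀ B' : Finset (MvPolynomial (MatIdx n) K),
        IsReducedGroebnerBasis (matLex n) (diagMinorIdeal K G) B' → B' = B) ∧
      ∀ g ∈ B, IsBinomial g ∧ 2 ≤ g.totalDegree ∧ g.totalDegree ≤ 4 ∧
        SquarefreeExp ((matLex n).degree g)) := by
  refine ⟨⟨smallLeads K G, fun e he => ⟨he.1, he.2.2.1⟩, initialIdeal_diagMinorIdeal⟩, ?_⟩
  obtain ⟨B, hB, hbin⟩ := exists_reducedGroebnerBasis_binomial (finite_smallLeads (K := K) (G := G))
    (fun u hu => hu.2.2.2) initialIdeal_diagMinorIdeal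
  refine ⟨B, hB, fun B' hB' => hB'.unique hB, fun g hg => ?_⟩
  obtain ⟨u, hu, v, hlt, rfl⟩ := hbin g hg
  have huv : u ≠ v := by
    rintro rfl
    exact lt_irrefl _ hlt
  have hhom : (monomial u (1 : K) - monomial v 1).IsHomogeneous u.degree :=
    (isHomogeneous_monomial 1 rfl).sub (isHomogeneous_monomial 1
      (degree_eq_of_rowDiff_eq (rowDiff_eq_of_binomial_mem (hB.subset hg))).symm)
  rw [hhom.totalDegree (monic_binomial hlt).ne_zero, degree_binomial hlt]
  exact ⟨⟨u, v, huv, rfl⟩, hu.2.1, hu.2.2.1, hu.1⟩
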